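/- Let $\omega=e^{2\pi i/3}$, index the computational basis of a qutrit by $\mathbb{Z}_3=\{0,1,2\}$, and let $H=\frac{1}{\sqrt3}\sum_{s,t\in\mathbb{Z}_3}\omega^{st}|s\rangle\langle t|$ be the qutrit Hadamard gate; write $H^{(1)}=H$ and $H^{(2)}=H^{\dagger}$, the superscript being read modulo $3$. For $b\in\mathbb{Z}_3$ let $Z(b)=|0\rangle\langle 0|+\omega^{b}|1\rangle\langle 1|+\omega^{b}|2\rangle\langle 2|$ be the $Z$-spider gate with phases $(b,b)$ in units of $2\pi/3$. Let $G$ be a finite graph with vertex set $V$ and symmetric weights $w_{u,v}\in\mathbb{Z}_3$, $w_{v,v}=0$, where weight $0$ means that there is no edge. Its graph state $|G\rangle\in(\mathbb{C}^3)^{\otimes V}$ is the interpretation of the qutrit ZX-diagram with one phaseless $Z$-spider for each vertex, each with one output wire, and with an $H$-edge (resp. $H^\dagger$-edge) between $u$ and $v$ whenever $w_{u,v}=1$ (resp. $w_{u,v}=2$). For $a\in\mathbb{Z}_3$ and a vertex $x$, the $a$-local complementation $G*_a x$ is the graph on $V$ with weights $w'_{u,v}=w_{u,v}+a\,w_{u,x}w_{v,x}$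 for $u\ne v$ (and $w'_{v,v}=0$). For vertices $i,j$, the proper $a$-pivot along $ij$ is $G\wedge_a ij=((G*_a i)*_{-a} j)*_a i$. **Theorem.** Let $a\in\{1,2\}$ and let $ij$ be an edge of $G$, i.e. $w_{i,j}\neq 0$. Then there are one-qutrit Clifford gates $U_v$ ($v\in V$) and a scalar $c\in\mathbb{C}\setminus\{0\}$ such that $$|G\rangle \;=\; c\,\Bigl(\bigotimes_{v\in V}U_v\Bigr)\,|G\wedge_a ij\rangle ,$$ where $U_i=H^{(-a)}$, $U_j=H^{(a)}$, and $U_k=Z(-w_{i,j}w_{i,k}w_{j,k})$ for every $k\in V\setminus\{i,j\}$. (So the only vertices other than $i,j$ whose gate is not the identity are the common neighbours of $i$ and $j$.) Here a one-qutrit Clifford gate is a unitary $U$ such that, for each Pauli operator $P=X^pZ^q$ (with $X|t\rangle=|t+1\rangle$, $Z|t\rangle=\omega^t|t\rangle$), $UPU^\dagger$ is again a Pauli operator up to a power of $\omega$. -/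

import Mathlib

open scoped Matrix

noncomputable section

namespace QutritZX

/-! The three computational basis vectors `|0⟩, |1⟩, |2⟩` of a qutrit are indexed by `ZMod 3`. -/

/-- The primitive cube root of unity `ω = e^{2πi/3}`. -/
def omega : ℂ := Complex.exp (2 * Real.pi * Complex.I / 3)

/-- The weight that a `Z`-spider with phases `α, β` gives to the basis label `k`. -/
def zPhase (α β : ℝ) (k : ZMod 3) : ℂ :=
  if k = 0 then 1
  else if k = 1 then Complex.exp (α * Complex.I)
  else Complex.exp (β * Complex.I)

/-- The tensor `|0…0⟩⟨0…0| + e^{iα} |1…1⟩⟨1…1| + e^{iβ} |2…2⟩⟨2…2|` of a (green) `Z`-spider, as a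
function of the labels of its legs. In this basis input legs and output legs contribute in the
same way, so that they need not be told apart. -/
def zSpider {ι : Type*} [Fintype ι] (α β : ℝ) (x : ι → ZMod 3) : ℂ :=
  ∑ k : ZMod 3, zPhase α β k * ∏ l : ι, (if x l = k then 1 else 0)

/-- The one-input one-output `Z`-spider whose phases are `2πm/3` and `2πn/3`. -/
def zGate (m n : ZMod 3) : Matrix (ZMod 3) (ZMod 3) ℂ :=
  Matrix.of fun s t => zSpider (2 * Real.pi / 3 * m.val) (2 * Real.pi / 3 * n.val) ![s, t]

/-- The qutrit Hadamard gate `|+⟩⟨0| + |ω⟩⟨1| + |ω̄⟩⟨2|`, with entries `ω^{st} / √3`. -/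
def hadamard : Matrix (ZMod 3) (ZMod 3) ℂ :=
  Matrix.of fun s t => ((Real.sqrt 3 : ℝ) : ℂ)⁻¹ * omega ^ (s.val * t.val)

/-- The box with decoration `h` modulo `3`: the Hadamard gate for `h = 1`, its adjoint for `h = 2`,
and a pair of disconnected phaseless spiders (one on either side) for `h = 0`. -/
def hBox (h : ZMod 3) : Matrix (ZMod 3) (ZMod 3) ℂ :=
  if h = 1 then hadamard
  else if h = 2 then hadamardᴴ
  else Matrix.of fun _ _ => 1

/-- A finite simple graph with edge weights in `ℤ/3`; weight `0` means that there is no edge. -/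
structure WGraph (V : Type*) where
  weight : V → V → ZMod 3
  symm : ∀ u v, weight u v = weight v u
  loopless : ∀ v, weight v v = 0

namespace WGraph

variable {V : Type*}

/-- The neighbours of `v`, that is, the edges at `v`. -/
abbrev Nbr (G : WGraph V) (v : V) : Type _ := {u : V // G.weight v u ≠ 0}

/-- The `a`-local complementation `G *_a x`. -/
def localComp [DecidableEq V] (G : WGraph V) (a : ZMod 3) (x : V) : WGraph V where
  weight u v := if u = v then 0 else G.weight u v + a * G.weight u x * G.weight v x
  symm u v := by
    by_cases h : u = v
    · simp [h]
    · rw [if_neg h, if_neg (Ne.symm h), G.symm u v]; ring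
  loopless v := by simp

/-- The `(a, b, c)`-pivot `((G *_a i) *_b j) *_c i`. -/
def pivot [DecidableEq V] (G : WGraph V) (a b c : ZMod 3) (i j : V) : WGraph V :=
  ((G.localComp a i).localComp b j).localComp c i

/-- The proper `a`-pivot `G ∧_a ij`. -/
def properPivot [DecidableEq V] (G : WGraph V) (a : ZMod 3) (i j : V) : WGraph V :=
  G.pivot a (-a) a i j

/-- The graph state of `G`, as the vector of its amplitudes: every vertex `v` is a phaseless
`Z`-spider with one output leg (`none`, labelled `s v`) and one leg for each edge at `v`; every edge
`uv` is a Hadamard box of decoration `G.weight u v` that joins the corresponding legs. The labels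
`x` of all inner legs are summed over. The order on `V` only serves to list each edge once. -/
def graphState [Fintype V] [LinearOrder V] (G : WGraph V) (s : V → ZMod 3) : ℂ :=
  ∑ x : (v : V) → G.Nbr v → ZMod 3,
    (∏ v : V, zSpider 0 0 fun l : Option (G.Nbr v) => l.elim (s v) (x v)) *
      ∏ u : V, ∏ v : G.Nbr u,
        if u < v.1 then
          hBox (G.weight u v.1) (x u v) (x v.1 ⟨u, by rw [G.symm]; exact v.2⟩)
        else 1

end WGraph

/-- The tensor product `⨂_v U_v` of one-qutrit gates, one on each output. -/
def localGate {V : Type*} [Fintype V] (U : V → Matrix (ZMod 3) (ZMod 3) ℂ) :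
    Matrix (V → ZMod 3) (V → ZMod 3) ℂ :=
  Matrix.of fun s t => ∏ v : V, U v (s v) (t v)

/-- The generalized Pauli operator `X^p Z^q`, which maps `|t⟩` to `ω^{qt} |t + p⟩`. -/
def pauli (p q : ZMod 3) : Matrix (ZMod 3) (ZMod 3) ℂ :=
  Matrix.of fun s t => if s = t + p then omega ^ (q * t).val else 0

/-- One-qutrit Clifford gates: unitaries that conjugate Pauli operators to Pauli operators,
up to phases in `{1, ω, ω²}`. -/
def IsClifford (U : Matrix (ZMod 3) (ZMod 3) ℂ) : Prop :=
  U ∈ Matrix.unitaryGroup (ZMod 3) ℂ ∧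
    ∀ p q : ZMod 3, ∃ (k : ℕ) (p' q' : ZMod 3), U * pauli p q * Uᴴ = omega ^ k • pauli p' q'

end QutritZX

end

open QutritZX

/-! Up to a scalar, the amplitude of a graph state at `s` is `chi` of the sum of `w_uv s_u s_v` over
the edges (`exists_graphState_eq`). The gates away from `i`, `j` are diagonal, so applying `U` to
the pivoted state leaves a sum over two labels `x`, `y` at `i`, `j`. The pivot is such that the
total exponent is the one of `G` plus `w_ij (x + p)(y - q)`, with `p`, `q` free of `x`, `y`
(`quadForm_properPivot`). The double sum of this nondegenerate bilinear phase is 3 for all `p`, `q`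
(`sum_sum_chi_shift`), so only the amplitude of `G` remains. -/

namespace QutritZX

/-! ### Characters of `ℤ/3` and matrix entries of the gates -/

/-- The additive character `k ↦ ω ^ k` of `ℤ/3`. -/
noncomputable abbrev chi : AddChar (ZMod 3) ℂ := ZMod.stdAddChar

theorem omega_eq_chi_one : omega = chi 1 := by
  have h := ZMod.stdAddChar_coe (N := 3) 1
  simp only [Int.cast_one] at h
  rw [chi, h, omega]
  norm_num

theorem omega_pow (n : ℕ) : omega ^ n = chi (n : ZMod 3) := by
  rw [omega_eq_chi_one, ← AddChar.map_nsmul_eq_pow, nsmul_one]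

theorem chi_sum {ι : Type*} (S : Finset ι) (f : ι → ZMod 3) :
    chi (∑ k ∈ S, f k) = ∏ k ∈ S, chi (f k) := by
  classical
  induction S using Finset.induction_on with
  | empty => simp
  | insert k S hk ih =>
    rw [Finset.sum_insert hk, Finset.prod_insert hk, AddChar.map_add_eq_mul, ih]

theorem star_chi (k : ZMod 3) : star (chi k) = chi (-k) :=
  (AddChar.map_neg_eq_conj chi k).symm

theorem sum_chi_mul (b : ZMod 3) : ∑ x : ZMod 3, chi (x * b) = if b = 0 then 3 else 0 := by
  have h := AddChar.sum_mulShift (ψ := chi) b (ZMod.isPrimitive_stdAddChar 3)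
  rw [h]
  split_ifs <;> simp [ZMod.card]

theorem sq_eq_one_of_ne_zero {h : ZMod 3} (hh : h ≠ 0) : h * h = 1 := by
  revert h; decide

theorem exp_eq_chi (m : ZMod 3) :
    Complex.exp (((2 * Real.pi / 3 * m.val : ℝ) : ℂ) * Complex.I) = chi m := by
  have h := omega_pow m.val
  rw [ZMod.natCast_zmod_val] at h
  rw [← h, omega, ← Complex.exp_nat_mul]
  congr 1
  push_cast
  ring

theorem zPhase_eq_chi (m k : ZMod 3) :
    zPhase (2 * Real.pi / 3 * m.val) (2 * Real.pi / 3 * m.val) k = chi (m * (k * k)) := by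
  unfold zPhase
  rw [exp_eq_chi]
  by_cases h0 : k = 0
  · simp [h0]
  · simp [h0, sq_eq_one_of_ne_zero h0]

theorem zGate_apply (m s t : ZMod 3) :
    zGate m m s t = if s = t then chi (m * (s * s)) else 0 := by
  simp only [zGate, Matrix.of_apply, zSpider, zPhase_eq_chi, Fin.prod_univ_two,
    Matrix.cons_val_zero, Matrix.cons_val_one]
  rw [Fintype.sum_eq_single s (fun k hk => by simp [hk.symm])]
  by_cases h : s = t
  · simp [h]
  · simp [h, Ne.symm h]

/-- The normalisation `1 / √3` of the Hadamard gate. -/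
noncomputable def hScale : ℂ := ((Real.sqrt 3 : ℝ) : ℂ)⁻¹

theorem hScale_mul_self : hScale * hScale = 3⁻¹ := by
  rw [hScale, ← mul_inv, ← Complex.ofReal_mul, Real.mul_self_sqrt (by norm_num)]
  norm_num

theorem hScale_ne_zero : hScale ≠ 0 := by
  intro h
  have := hScale_mul_self
  rw [h] at this
  norm_num at this

theorem star_hScale : star hScale = hScale := by
  simp [hScale]

theorem hadamard_apply (s t : ZMod 3) : hadamard s t = hScale * chi (s * t) := by
  simp [hadamard, omega_pow, hScale]

theorem hBox_apply {h : ZMod 3} (hh : h ≠ 0) (s t : ZMod 3) :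
    hBox h s t = hScale * chi (h * (s * t)) := by
  have h12 : h = 1 ∨ h = 2 := by revert h; decide
  rcases h12 with rfl | rfl
  · simp [hBox, hadamard_apply]
  · rw [hBox, if_neg (by decide), if_pos rfl, Matrix.conjTranspose_apply, hadamard_apply,
      star_mul', star_hScale, star_chi]
    congr 2
    rw [show (2 : ZMod 3) = -1 by decide]
    ring

theorem pauli_apply (p q s t : ZMod 3) :
    pauli p q s t = if s = t + p then chi (q * t) else 0 := by
  simp [pauli, omega_pow]

/-! ### The gates are Clifford -/

/-- Each entry of the conjugate is a character sum over `t`, which vanishes off one shifted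
diagonal. Unitarity is the case `p = q = 0`. -/
theorem isClifford_hBox {h : ZMod 3} (hh : h ≠ 0) : IsClifford (hBox h) := by
  have key : ∀ p q, hBox h * pauli p q * (hBox h)ᴴ
      = omega ^ (-(p * q)).val • pauli (-(h * q)) (h * p) := by
    intro p q
    ext s r
    have hcalc : ∀ t, (hBox h * pauli p q) s t * (hBox h)ᴴ t r
        = 3⁻¹ * chi (h * s * p) * chi (t * (h * s + q - h * r)) := by
      intro t
      rw [Matrix.mul_apply, Fintype.sum_eq_single (t + p)
        (fun k hk => by rw [pauli_apply, if_neg hk, mul_zero]), pauli_apply, if_pos rfl,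
        Matrix.conjTranspose_apply, hBox_apply hh, hBox_apply hh, star_mul', star_hScale, star_chi,
        ← hScale_mul_self]
      have e : chi (h * (s * (t + p))) * chi (q * t) * chi (-(h * (r * t)))
          = chi (h * s * p) * chi (t * (h * s + q - h * r)) := by
        simp only [← AddChar.map_add_eq_mul]
        congr 1
        ring
      linear_combination hScale * hScale * e
    rw [Matrix.mul_apply, Finset.sum_congr rfl fun t _ => hcalc t, ← Finset.mul_sum, sum_chi_mul,
      Matrix.smul_apply, pauli_apply, omega_pow, ZMod.natCast_zmod_val, smul_eq_mul]
    have hiff : h * s + q - h * r = 0 ↔ s = r + -(h * q) := by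
      have h1 := sq_eq_one_of_ne_zero hh
      constructor
      · intro e
        linear_combination h * e + (r - s) * h1
      · rintro rfl
        linear_combination (-q) * h1
    by_cases hs : s = r + -(h * q)
    · rw [if_pos (hiff.2 hs), if_pos hs, ← AddChar.map_add_eq_mul]
      have : h * s * p = -(p * q) + h * p * r := by
        rw [hs]
        linear_combination (-(p * q)) * sq_eq_one_of_ne_zero hh
      rw [this]
      ring
    · rw [if_neg (mt hiff.1 hs), if_neg hs]
      simp
  refine ⟨?_, fun p q => ⟨_, _, _, key p q⟩⟩
  have hone : pauli 0 0 = 1 := by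
    ext s t
    simp [pauli_apply, Matrix.one_apply]
  rw [Matrix.mem_unitaryGroup_iff]
  have h0 := key 0 0
  simpa [hone, Matrix.star_eq_conjTranspose] using h0

theorem zGate_eq_diagonal (m : ZMod 3) :
    zGate m m = Matrix.diagonal fun s => chi (m * (s * s)) := by
  ext s t
  rw [zGate_apply, Matrix.diagonal_apply]

theorem isClifford_zGate (m : ZMod 3) : IsClifford (zGate m m) := by
  have hstar : (zGate m m)ᴴ = Matrix.diagonal fun s => chi (-(m * (s * s))) := by
    rw [zGate_eq_diagonal, Matrix.diagonal_conjTranspose]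
    congr 1
    funext s
    exact star_chi _
  constructor
  · rw [Matrix.mem_unitaryGroup_iff, Matrix.star_eq_conjTranspose, hstar, zGate_eq_diagonal,
      Matrix.diagonal_mul_diagonal]
    simp only [← AddChar.map_add_eq_mul, add_neg_cancel, AddChar.map_zero_eq_one,
      Matrix.diagonal_one]
  · intro p q
    -- From `m (t + p)² - m t² = 2mpt + mp²`: the linear part changes the power of `Z`, the constant
    -- is the phase.
    refine ⟨(m * p * p).val, p, q + 2 * m * p, ?_⟩
    ext s t
    rw [hstar, zGate_eq_diagonal, Matrix.mul_diagonal, Matrix.diagonal_mul, Matrix.smul_apply,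
      pauli_apply, pauli_apply, omega_pow, ZMod.natCast_zmod_val, smul_eq_mul]
    by_cases hs : s = t + p
    · subst hs
      simp only [if_true, ← AddChar.map_add_eq_mul]
      congr 1
      ring
    · simp [hs]

/-! ### Graph states as quadratic phases -/

theorem zSpider_zero_elim {ι : Type*} [Fintype ι] [DecidableEq ι] (s : ZMod 3) (x : ι → ZMod 3) :
    zSpider 0 0 (fun l : Option ι => l.elim s x) = if x = fun _ => s then 1 else 0 := by
  have hz : ∀ k, zPhase 0 0 k = 1 := by intro k; simp [zPhase]
  have hfactor : zSpider 0 0 (fun l : Option ι => l.elim s x)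
      = ∑ k, (if s = k then 1 else 0) * ∏ i, if x i = k then 1 else 0 := by
    simp only [zSpider, hz, one_mul]
    exact Finset.sum_congr rfl fun k _ => Fintype.prod_option _
  rw [hfactor, Fintype.sum_eq_single s (fun k hk => by simp [hk.symm]), if_pos rfl, one_mul,
    Finset.prod_ite_zero]
  simp [funext_iff]

namespace WGraph

variable {V : Type*} [Fintype V]

/-- The quadratic form `∑_{u,v} w_{u,v} s_u s_v`, in which each edge is counted twice. -/
def quadForm (G : WGraph V) (s : V → ZMod 3) : ZMod 3 :=
  ∑ u, ∑ v, G.weight u v * (s u * s v)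

theorem two_mul_sum_lt [LinearOrder V] (G : WGraph V) (s : V → ZMod 3) :
    2 * ∑ u, ∑ v, (if u < v then G.weight u v * (s u * s v) else 0) = G.quadForm s := by
  rw [two_mul]
  nth_rw 2 [Finset.sum_comm]
  rw [quadForm, ← Finset.sum_add_distrib]
  refine Finset.sum_congr rfl fun u _ => ?_
  rw [← Finset.sum_add_distrib]
  refine Finset.sum_congr rfl fun v _ => ?_
  rcases lt_trichotomy u v with h | rfl | h
  · simp [h, h.not_gt]
  · simp [G.loopless]
  · rw [if_neg h.not_gt, if_pos h, G.symm u v]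
    ring

/-- The phaseless spiders force every inner leg to carry the output label of its vertex. The factor
2 is the inverse of 2 modulo 3 and undoes the double count in `quadForm`. -/
theorem exists_graphState_eq [LinearOrder V] (G : WGraph V) :
    ∃ c : ℂ, c ≠ 0 ∧ ∀ s, G.graphState s = c * chi (2 * G.quadForm s) := by
  refine ⟨∏ u : V, ∏ v : G.Nbr u, if u < v.1 then hScale else 1, ?_, fun s => ?_⟩
  · refine Finset.prod_ne_zero_iff.2 fun u _ => Finset.prod_ne_zero_iff.2 fun v _ => ?_
    split_ifs
    exacts [hScale_ne_zero, one_ne_zero]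
  have hspider : ∀ x : (v : V) → G.Nbr v → ZMod 3,
      (∏ v : V, zSpider 0 0 fun l : Option (G.Nbr v) => l.elim (s v) (x v))
        = if x = fun v _ => s v then 1 else 0 := by
    intro x
    simp only [zSpider_zero_elim]
    rw [Finset.prod_ite_zero]
    simp [funext_iff]
  unfold graphState
  rw [Fintype.sum_eq_single (fun v _ => s v) (fun x hx => by rw [hspider, if_neg hx, zero_mul]),
    hspider, if_pos rfl, one_mul]
  have hexp : 2 * G.quadForm s
      = ∑ u, ∑ v : G.Nbr u, if u < v.1 then G.weight u v.1 * (s u * s v.1) else 0 := by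
    rw [← two_mul_sum_lt, ← mul_assoc, show (2 * 2 : ZMod 3) = 1 by decide, one_mul]
    refine Finset.sum_congr rfl fun u _ => ?_
    symm
    refine Fintype.sum_of_injective Subtype.val Subtype.val_injective _ _ (fun v hv => ?_)
      fun _ => rfl
    have h0 : G.weight u v = 0 := by
      by_contra h
      exact hv ⟨⟨v, h⟩, rfl⟩
    simp [h0]
  rw [hexp, chi_sum, ← Finset.prod_mul_distrib]
  refine Finset.prod_congr rfl fun u _ => ?_
  rw [chi_sum, ← Finset.prod_mul_distrib]
  refine Finset.prod_congr rfl fun v _ => ?_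
  split_ifs
  · exact hBox_apply v.2 _ _
  · simp

/-! ### Splitting off the vertices `i` and `j` -/

/-- The vertices other than `i` and `j`. -/
def others [DecidableEq V] (i j : V) : Finset V := (Finset.univ.erase i).erase j

theorem mem_others [DecidableEq V] {i j k : V} : k ∈ others i j ↔ k ≠ i ∧ k ≠ j := by
  simp [others, and_comm]

theorem sum_eq_add_others {M : Type*} [AddCommMonoid M] [DecidableEq V] {i j : V} (hij : i ≠ j)
    (f : V → M) : ∑ u, f u = f i + (f j + ∑ k ∈ others i j, f k) := by
  rw [others, Finset.add_sum_erase _ f (by simp [hij.symm]),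
    Finset.add_sum_erase _ f (Finset.mem_univ i)]

theorem prod_eq_mul_others {M : Type*} [CommMonoid M] [DecidableEq V] {i j : V} (hij : i ≠ j)
    (f : V → M) : ∏ u, f u = f i * (f j * ∏ k ∈ others i j, f k) := by
  rw [others, Finset.mul_prod_erase _ f (by simp [hij.symm]),
    Finset.mul_prod_erase _ f (Finset.mem_univ i)]

theorem quadForm_eq_others [DecidableEq V] (G : WGraph V) {i j : V} (hij : i ≠ j)
    (s : V → ZMod 3) :
    G.quadForm s = 2 * (G.weight i j * (s i * s j)
      + s i * ∑ k ∈ others i j, G.weight i k * s k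
      + s j * ∑ k ∈ others i j, G.weight j k * s k)
      + ∑ k ∈ others i j, ∑ l ∈ others i j, G.weight k l * (s k * s l) := by
  have hrow : ∀ u, ∑ l ∈ others i j, G.weight u l * (s u * s l)
      = s u * ∑ l ∈ others i j, G.weight u l * s l := by
    intro u
    rw [Finset.mul_sum]
    exact Finset.sum_congr rfl fun l _ => by ring
  have hcol : ∀ u, ∑ l ∈ others i j, G.weight l u * (s l * s u)
      = s u * ∑ l ∈ others i j, G.weight u l * s l := by
    intro u
    rw [Finset.mul_sum]
    exact Finset.sum_congr rfl fun l _ => by rw [G.symm l u]; ring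
  rw [quadForm]
  simp only [sum_eq_add_others hij, Finset.sum_add_distrib, hcol]
  rw [hrow i, hrow j, G.loopless, G.loopless, G.symm j i]
  ring

/-! ### Weights and quadratic form of the pivot -/

section Pivot

/-- The three summands are the increments of the three complementations; `n, m` are the weights from
`k` to `i, j`, and `n', m'` those from `l`. -/
theorem pivot_weight_identity {R : Type*} [CommRing R] {a w : R} (ha : a * a = 1) (hw : w * w = 1)
    (n m n' m' : R) :
    a * n * n' - a * (m + a * n * w) * (m' + a * n' * w)
        + a * (n - a * (m + a * n * w) * w) * (n' - a * (m' + a * n' * w) * w)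
      = -(w * (n * m' + m * n')) := by
  grind

/-- Here `x, y` are the labels of `s` at `i, j` and `x', y'` those of `t`; `N, M` are the weighted
sums over the other neighbours of `i, j`. The spider phase `-D` cancels `4D = D`. -/
theorem pivot_exponent_identity {R : Type*} [CommRing R] (h3 : (3 : R) = 0) {a w : R}
    (ha : a * a = 1) (hw : w * w = 1) (x y x' y' N M S D : R) :
    -a * (x * x') + a * (y * y') - D
        + 2 * (2 * (w * (x' * y') + x' * (-(a * w) * M) + y' * (a * w * N))
          + (S - 2 * w * (N * M) + 2 * D))
      = w * ((x' + a * (w * y + N)) * (y' - a * (w * x + M)))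
        + 2 * (2 * (w * (x * y) + x * N + y * M) + S) := by
  grind

variable {V : Type*} [DecidableEq V] (G : WGraph V) {i j : V} {a : ZMod 3}

theorem properPivot_weight_left_right (hij : i ≠ j) :
    (G.properPivot a i j).weight i j = G.weight i j := by
  simp [properPivot, pivot, localComp, hij, G.loopless]

theorem properPivot_weight_left (hij : i ≠ j) (hw : G.weight i j ≠ 0) (ha : a ≠ 0) {k : V}
    (hki : k ≠ i) (hkj : k ≠ j) :
    (G.properPivot a i j).weight i k = -(a * G.weight i j * G.weight j k) := by
  have h1 := sq_eq_one_of_ne_zero hw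
  have h2 := sq_eq_one_of_ne_zero ha
  simp only [properPivot, pivot, localComp, hij, hki, hkj, hki.symm, if_true,
    if_false, G.loopless, G.symm k i, G.symm k j, G.symm j i]
  linear_combination (-(G.weight i j * G.weight i j * G.weight i k)) * h2 - G.weight i k * h1

theorem properPivot_weight_right (hij : i ≠ j) (hw : G.weight i j ≠ 0) (ha : a ≠ 0) {k : V}
    (hki : k ≠ i) (hkj : k ≠ j) :
    (G.properPivot a i j).weight j k = a * G.weight i j * G.weight i k := by
  have h1 := sq_eq_one_of_ne_zero hw
  have h2 := sq_eq_one_of_ne_zero ha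
  simp only [properPivot, pivot, localComp, hij, hij.symm, hki, hkj, hkj.symm, if_true,
    if_false, G.loopless, G.symm k i, G.symm k j, G.symm j i]
  generalize G.weight i j = w at *
  generalize G.weight i k = n
  generalize G.weight j k = m
  clear h1 h2
  -- Only four elements of `ℤ/3` are left, so all cases can be checked.
  revert w a n m
  decide

theorem properPivot_weight_others (hij : i ≠ j) (hw : G.weight i j ≠ 0) (ha : a ≠ 0) {k l : V}
    (hki : k ≠ i) (hkj : k ≠ j) (hli : l ≠ i) (hlj : l ≠ j) :
    (G.properPivot a i j).weight k l = if k = l then 0 else G.weight k l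
      - G.weight i j * (G.weight i k * G.weight j l + G.weight j k * G.weight i l) := by
  by_cases hkl : k = l
  · subst hkl
    rw [loopless, if_pos rfl]
  simp only [properPivot, pivot, localComp, hij, hki, hkj, hli, hlj, hkl, if_false, G.loopless, G.symm k i, G.symm k j, G.symm j i, G.symm l i, G.symm l j]
  linear_combination pivot_weight_identity (sq_eq_one_of_ne_zero ha) (sq_eq_one_of_ne_zero hw)
    (G.weight i k) (G.weight j k) (G.weight i l) (G.weight j l)

end Pivot

/-- Expanding the product of the two sums also yields terms `k = l`, but the pivot has no loops. The
last sum restores these terms; it is what the gates at common neighbours compensate. -/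
theorem sum_properPivot_others [DecidableEq V] (G : WGraph V) {i j : V} (hij : i ≠ j)
    (hw : G.weight i j ≠ 0) {a : ZMod 3} (ha : a ≠ 0) (s : V → ZMod 3) :
    ∑ k ∈ others i j, ∑ l ∈ others i j, (G.properPivot a i j).weight k l * (s k * s l)
      = ∑ k ∈ others i j, ∑ l ∈ others i j, G.weight k l * (s k * s l)
        - 2 * G.weight i j * ((∑ k ∈ others i j, G.weight i k * s k)
            * ∑ k ∈ others i j, G.weight j k * s k)
        + 2 * ∑ k ∈ others i j,
            G.weight i j * G.weight i k * G.weight j k * (s k * s k) := by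
  have hpt : ∀ k ∈ others i j, ∀ l ∈ others i j,
      (G.properPivot a i j).weight k l * (s k * s l)
        = G.weight k l * (s k * s l)
          - G.weight i j * ((G.weight i k * s k) * (G.weight j l * s l))
          - G.weight i j * ((G.weight j k * s k) * (G.weight i l * s l))
          + if k = l then 2 * (G.weight i j * G.weight i k * G.weight j k * (s k * s k)) else 0 := by
    intro k hk l hl
    rw [mem_others] at hk hl
    rw [properPivot_weight_others G hij hw ha hk.1 hk.2 hl.1 hl.2]
    by_cases h : k = l
    · subst h
      rw [if_pos rfl, if_pos rfl, G.loopless]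
      ring
    · rw [if_neg h, if_neg h]
      ring
  rw [Finset.sum_congr rfl fun k hk => Finset.sum_congr rfl fun l hl => hpt k hk l hl]
  simp only [Finset.sum_add_distrib, Finset.sum_sub_distrib, ← Finset.mul_sum, ← Finset.sum_mul]
  have hdiag : ∀ f : V → ZMod 3, ∑ k ∈ others i j, ∑ l ∈ others i j, (if k = l then f k else 0)
      = ∑ k ∈ others i j, f k := fun f =>
    Finset.sum_congr rfl fun k hk => by rw [Finset.sum_ite_eq, if_pos hk]
  rw [hdiag, ← Finset.mul_sum]
  ring

theorem quadForm_properPivot [DecidableEq V] (G : WGraph V) {i j : V} (hij : i ≠ j)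
    (hw : G.weight i j ≠ 0) {a : ZMod 3} (ha : a ≠ 0) {s t : V → ZMod 3}
    (hst : ∀ k ∈ others i j, t k = s k) :
    -a * (s i * t i) + a * (s j * t j)
        - ∑ k ∈ others i j, G.weight i j * G.weight i k * G.weight j k * (s k * s k)
        + 2 * (G.properPivot a i j).quadForm t
      = G.weight i j
          * ((t i + a * (G.weight i j * s j + ∑ k ∈ others i j, G.weight i k * s k))
            * (t j - a * (G.weight i j * s i + ∑ k ∈ others i j, G.weight j k * s k)))
        + 2 * G.quadForm s := by
  have hl : ∑ k ∈ others i j, (G.properPivot a i j).weight i k * t k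
      = -(a * G.weight i j) * ∑ k ∈ others i j, G.weight j k * s k := by
    rw [Finset.mul_sum]
    refine Finset.sum_congr rfl fun k hk => ?_
    rw [hst k hk, G.properPivot_weight_left hij hw ha (mem_others.1 hk).1 (mem_others.1 hk).2]
    ring
  have hr : ∑ k ∈ others i j, (G.properPivot a i j).weight j k * t k
      = (a * G.weight i j) * ∑ k ∈ others i j, G.weight i k * s k := by
    rw [Finset.mul_sum]
    refine Finset.sum_congr rfl fun k hk => ?_
    rw [hst k hk, G.properPivot_weight_right hij hw ha (mem_others.1 hk).1 (mem_others.1 hk).2]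
    ring
  have ho : ∑ k ∈ others i j, ∑ l ∈ others i j, (G.properPivot a i j).weight k l * (t k * t l)
      = ∑ k ∈ others i j, ∑ l ∈ others i j, (G.properPivot a i j).weight k l * (s k * s l) :=
    Finset.sum_congr rfl fun k hk => Finset.sum_congr rfl fun l hl => by rw [hst k hk, hst l hl]
  rw [quadForm_eq_others _ hij, quadForm_eq_others G hij, hl, hr, ho,
    sum_properPivot_others G hij hw ha, G.properPivot_weight_left_right hij]
  exact pivot_exponent_identity (by decide) (sq_eq_one_of_ne_zero ha) (sq_eq_one_of_ne_zero hw)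
    _ _ _ _ _ _ _ _

/-! ### Summation over the labels at `i` and `j` -/

theorem sum_eq_sum_update [DecidableEq V] {i j : V} (hij : i ≠ j) (s : V → ZMod 3)
    (f : (V → ZMod 3) → ℂ) (hf : ∀ t, (∃ k ∈ others i j, t k ≠ s k) → f t = 0) :
    ∑ t, f t = ∑ x : ZMod 3, ∑ y : ZMod 3, f (Function.update (Function.update s i x) j y) := by
  rw [← Fintype.sum_prod_type']
  symm
  refine Fintype.sum_of_injective
    (fun p : ZMod 3 × ZMod 3 => Function.update (Function.update s i p.1) j p.2) ?_ _ _ ?_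
    fun _ => rfl
  · intro p q h
    have hi := congrFun h i
    have hj := congrFun h j
    simp only [Function.update_self, Function.update_of_ne hij] at hi hj
    exact Prod.ext hi hj
  · intro t ht
    refine hf t ?_
    by_contra! hcon
    refine ht ⟨(t i, t j), ?_⟩
    funext k
    by_cases hkj : k = j
    · subst hkj; simp
    by_cases hki : k = i
    · subst hki; simp [hij]
    · simp [hkj, hki, hcon k (mem_others.2 ⟨hki, hkj⟩)]

/-- Summing over `y` first kills every `x` except `-p`. -/
theorem sum_sum_chi_shift {w : ZMod 3} (hw : w ≠ 0) (p q : ZMod 3) :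
    ∑ x : ZMod 3, ∑ y : ZMod 3, chi (w * ((x + p) * (y - q))) = 3 := by
  have h : ∀ x, ∑ y : ZMod 3, chi (w * ((x + p) * (y - q))) = if x = -p then 3 else 0 := by
    intro x
    rw [Fintype.sum_equiv (Equiv.subRight q) _ (fun y => chi (y * (w * (x + p))))
      (fun y => by rw [Equiv.subRight_apply]; congr 1; ring), sum_chi_mul]
    simp [hw, eq_neg_iff_add_eq_zero]
  simp [h]

end WGraph

end QutritZX

/-! ### Proof of the theorem -/

open QutritZX WGraph in
theorem mainTheorem2 {V : Type*} [Fintype V] [LinearOrder V] (G : WGraph V) (i j : V)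
    (hij : G.weight i j ≠ 0) (a : ZMod 3) (ha : a ≠ 0) :
    ∃ U : V → Matrix (ZMod 3) (ZMod 3) ℂ,
      (∀ v, IsClifford (U v)) ∧
      U i = hBox (-a) ∧
      U j = hBox a ∧
      (∀ k, k ≠ i → k ≠ j →
        U k = zGate (-(G.weight i j * G.weight i k * G.weight j k))
          (-(G.weight i j * G.weight i k * G.weight j k))) ∧
      ∃ c : ℂ, c ≠ 0 ∧
        G.graphState = c • (localGate U *ᵥ (G.properPivot a i j).graphState) := by
  have hne : i ≠ j := by
    rintro rfl
    exact hij (G.loopless i)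
  have hna : -a ≠ 0 := neg_ne_zero.2 ha
  obtain ⟨c₁, hc₁, h₁⟩ := G.exists_graphState_eq
  obtain ⟨c₂, hc₂, h₂⟩ := (G.properPivot a i j).exists_graphState_eq
  set U : V → Matrix (ZMod 3) (ZMod 3) ℂ := fun k =>
    if k = i then hBox (-a) else if k = j then hBox a else
      zGate (-(G.weight i j * G.weight i k * G.weight j k))
        (-(G.weight i j * G.weight i k * G.weight j k)) with hU
  have hUi : U i = hBox (-a) := by simp [hU]
  have hUj : U j = hBox a := by simp [hU, hne.symm]
  have hUk : ∀ k, k ≠ i → k ≠ j →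
      U k = zGate (-(G.weight i j * G.weight i k * G.weight j k))
        (-(G.weight i j * G.weight i k * G.weight j k)) := by
    intro k hki hkj
    simp [hU, hki, hkj]
  -- No power of 3 enters the scalar: the two Hadamard normalisations give `3⁻¹`, which cancels the
  -- 3 of the double sum.
  refine ⟨U, fun v => ?_, hUi, hUj, hUk, c₁ * c₂⁻¹, mul_ne_zero hc₁ (inv_ne_zero hc₂), ?_⟩
  · by_cases hvi : v = i
    · rw [hvi, hUi]; exact isClifford_hBox hna
    by_cases hvj : v = j
    · rw [hvj, hUj]; exact isClifford_hBox ha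
    rw [hUk v hvi hvj]
    exact isClifford_zGate _
  funext s
  have hterm : ∀ t : V → ZMod 3, (∀ k ∈ others i j, t k = s k) →
      localGate U s t * (G.properPivot a i j).graphState t = c₂ * 3⁻¹ * chi (2 * G.quadForm s)
        * chi (G.weight i j
          * ((t i + a * (G.weight i j * s j + ∑ k ∈ others i j, G.weight i k * s k))
            * (t j - a * (G.weight i j * s i + ∑ k ∈ others i j, G.weight j k * s k)))) := by
    intro t ht
    have hprod : ∏ k ∈ others i j, U k (s k) (t k) = chi (-∑ k ∈ others i j,
        G.weight i j * G.weight i k * G.weight j k * (s k * s k)) := by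
      rw [← Finset.sum_neg_distrib, chi_sum]
      refine Finset.prod_congr rfl fun k hk => ?_
      rw [ht k hk, hUk k (mem_others.1 hk).1 (mem_others.1 hk).2, zGate_apply, if_pos rfl, neg_mul]
    have e := congrArg chi (G.quadForm_properPivot hne hij ha ht)
    rw [sub_eq_add_neg, AddChar.map_add_eq_mul, AddChar.map_add_eq_mul, AddChar.map_add_eq_mul,
      AddChar.map_add_eq_mul _ _ (2 * G.quadForm s)] at e
    rw [localGate, Matrix.of_apply, prod_eq_mul_others hne, hprod, hUi, hUj, hBox_apply hna,
      hBox_apply ha, h₂, ← hScale_mul_self]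
    linear_combination c₂ * hScale * hScale * e
  have hzero : ∀ t : V → ZMod 3, (∃ k ∈ others i j, t k ≠ s k) →
      localGate U s t * (G.properPivot a i j).graphState t = 0 := by
    rintro t ⟨k, hk, hks⟩
    rw [localGate, Matrix.of_apply, Finset.prod_eq_zero (Finset.mem_univ k), zero_mul]
    rw [hUk k (mem_others.1 hk).1 (mem_others.1 hk).2, zGate_apply, if_neg hks.symm]
  have hsum : (localGate U *ᵥ (G.properPivot a i j).graphState) s
      = c₂ * chi (2 * G.quadForm s) := by
    rw [Matrix.mulVec, dotProduct, sum_eq_sum_update hne s _ hzero]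
    rw [Finset.sum_congr rfl fun x _ => Finset.sum_congr rfl fun y _ => hterm _ (fun k hk => by
      rw [Function.update_of_ne (mem_others.1 hk).2, Function.update_of_ne (mem_others.1 hk).1])]
    simp only [Function.update_self, Function.update_of_ne hne, ← Finset.mul_sum]
    rw [sum_sum_chi_shift hij]
    ring
  rw [Pi.smul_apply, hsum, h₁, smul_eq_mul]
  field_simp
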